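/- Let $R$ be a commutative unital ring with group of units $R^\times$ (discrete), and let $\Gamma$ be a discrete group. A topological groupoid $G$ (with range $r(\alpha)=\alpha\alpha^{-1}$, source $s(\alpha)=\alpha^{-1}\alpha$, unit space $G^{(0)}$) is \emph{ample} if it has a basis of compact open bisections, where an open bisection is an open set $B\subseteq G$ such that $r(B),s(B)$ are open and $r|_B,s|_B$ are homeomorphisms onto their images. Let $G$ be an ample Hausdorff groupoid. A \emph{discrete $R$-twist} over $G$ is a sequence $G^{(0)}\times R^\times\xrightarrow{\,i\,}\Sigma\xrightarrow{\,q\,}G$, where $G^{(0)}\times R^\times$ is the trivial group bundle, $\Sigma$ is a topological groupoid, and $i,q$ are continuous groupoid homomorphisms that restrict to homeomorphisms of unit spaces, such that: (1) $i$ is injective, $q$ is surjective, and $i(\{x\}\times R^\times)=q^{-1}(x)$ for every $x\in G^{(0)}$; (2) every $\alpha\in G$ lies in an open bisection $B$ for which there is a continuous map $P:B\to\Sigma$ with $q\circ P=\mathrm{id}_B$ such that $(\beta,t)\mapsto i(r(\beta),t)P(\beta)$ is a homeomorphism of $B\times R^\times$ onto $q^{-1}(B)$; (3) $i(r(\sigma),t)\,\sigma=\sigma\,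 i(s(\sigma),t)$ for all $\sigma\in\Sigma$, $t\in R^\times$ (identifying $\Sigma^{(0)}$ with $G^{(0)}$ via $q$). The twist is \emph{$\Gamma$-graded} if it comes with continuous groupoid homomorphisms $c_\Sigma:\Sigma\to\Gamma$ and $c_G:G\to\Gamma$ with $c_\Sigma=c_G\circ q$. Put $G_\gamma=c_G^{-1}(\gamma)$ and $t\cdot\sigma=i(r(\sigma),t)\sigma$. For $f:\Sigma\to R$ let $\operatorname{supp}f=\{\sigma: f(\sigma)\ne0\}$ and $\operatorname{supp}_G f=q(\operatorname{supp}f)$. Let $A_R(G;\Sigma)$ be the $R$-module (with pointwise operations) of all locally constant $f:\Sigma\to R$ such that $f(t\cdot\sigma)=t^{-1}f(\sigma)$ for all $t\in R^\times$, $\sigma\in\Sigma$, and $\operatorname{supp}_G f$ is compact. \textbf{Proposition.} Let $(\Sigma,i,q,c_G)$ be a $\Gamma$-graded discrete $R$-twist over an ample Hausdorff groupoid $G$. Then $A_R(G;\Sigma)$ is a $\Gamma$-graded $R$-algebra with homogeneous components $$A_R(G;\Sigma)_\gamma=\{f\in A_R(G;\Sigma):\operatorname{supp}_G f\subseteq G_\gamma\}\qquad(\gamma\in\Gamma).$$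 Explicitly: for $f,g\in A_R(G;\Sigma)$ and any (not necessarily continuous) section $S$ of $q$ on $\operatorname{supp}_G f$, the sum $$(f*g)(\sigma)=\sum_{\alpha\in\operatorname{supp}_G f,\ r(\alpha)=r(q(\sigma))} f(S(\alpha))\,g(S(\alpha)^{-1}\sigma)$$ is finite for every $\sigma\in\Sigma$, it does not depend on $S$, and $*$ is an associative $R$-bilinear product on $A_R(G;\Sigma)$; moreover $A_R(G;\Sigma)=\bigoplus_{\gamma\in\Gamma}A_R(G;\Sigma)_\gamma$ as $R$-modules, and $A_R(G;\Sigma)_\gamma * A_R(G;\Sigma)_\delta\subseteq A_R(G;\Sigma)_{\gamma\delta}$ for all $\gamma,\delta\in\Gamma$. -/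

import Mathlib

open Topology

namespace TwistedSteinberg

/-- A groupoid, as a set of arrows `G` with a set of composable pairs `Comp`, a multiplication on
composable pairs and an inversion. The values of `mul` on pairs that are not composable are
irrelevant: no axiom or definition below uses them. -/
class ArrowGroupoid (G : Type*) where
  Comp : G → G → Prop
  mul : G → G → G
  inv : G → G
  inv_invol : ∀ a, inv (inv a) = a
  comp_mul_left : ∀ {a b c}, Comp a b → Comp b c → Comp (mul a b) c
  comp_mul_right : ∀ {a b c}, Comp a b → Comp b c → Comp a (mul b c)
  assoc : ∀ {a b c}, Comp a b → Comp b c → mul (mul a b) c = mul a (mul b c)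
  comp_inv : ∀ a, Comp a (inv a)
  inv_mul_mul : ∀ {a b}, Comp a b → mul (inv a) (mul a b) = b
  mul_mul_inv : ∀ {a b}, Comp a b → mul (mul a b) (inv b) = a

open ArrowGroupoid

section Groupoids

variable {G : Type*} [ArrowGroupoid G]

/-- The source `s(a) = a⁻¹ a`. -/
def src (a : G) : G := mul (inv a) a

/-- The range `r(a) = a a⁻¹`. -/
def rng (a : G) : G := mul a (inv a)

variable (G) in
/-- The unit space `G⁽⁰⁾`. -/
def unitSpace : Set G := Set.range (src : G → G)

theorem src_mem (a : G) : src a ∈ unitSpace G := ⟨a, rfl⟩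

theorem rng_eq_src_inv (a : G) : rng a = src (inv a) := by
  simp [rng, src, inv_invol]

theorem rng_mem (a : G) : rng a ∈ unitSpace G := ⟨inv a, (rng_eq_src_inv a).symm⟩

/-- `r(a)`, as a point of the unit space. -/
def rngU (a : G) : unitSpace G := ⟨rng a, rng_mem a⟩

/-- `s(a)`, as a point of the unit space. -/
def srcU (a : G) : unitSpace G := ⟨src a, src_mem a⟩

/-- A groupoid homomorphism. -/
def IsHom {H : Type*} [ArrowGroupoid H] (f : G → H) : Prop :=
  ∀ a b, Comp a b → Comp (f a) (f b) ∧ f (mul a b) = mul (f a) (f b)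

/-- A groupoid homomorphism into a group (all pairs in a group are composable). -/
def IsCocycle {Γ : Type*} [Group Γ] (c : G → Γ) : Prop :=
  ∀ a b, Comp a b → c (mul a b) = c a * c b

variable (G) in
/-- Inversion and composition (on the space of composable pairs) are continuous. -/
class IsTopGroupoid [TopologicalSpace G] : Prop where
  continuous_inv : Continuous (inv : G → G)
  continuousOn_mul : ContinuousOn (fun p : G × G => mul p.1 p.2) {p : G × G | Comp p.1 p.2}

/-- An open set `B` with `r(B)`, `s(B)` open, on which `r` and `s` are homeomorphisms onto their
images. -/
structure IsOpenBisection [TopologicalSpace G] (B : Set G) : Prop where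
  isOpen : IsOpen B
  isOpen_rng : IsOpen (rng '' B)
  isOpen_src : IsOpen (src '' B)
  rng_embedding : IsEmbedding (B.domRestrict rng)
  src_embedding : IsEmbedding (B.domRestrict src)

variable (G) in
/-- A topological groupoid with a basis of compact open bisections. -/
class IsAmple [TopologicalSpace G] : Prop extends IsTopGroupoid G where
  isBasis : TopologicalSpace.IsTopologicalBasis {B : Set G | IsCompact B ∧ IsOpenBisection B}

/-- `f` restricts to a homeomorphism from the unit space of `G` onto the unit space of `H`. -/
def RestrictsToUnitHomeo {H : Type*} [ArrowGroupoid H] [TopologicalSpace G] [TopologicalSpace H]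
    (f : G → H) : Prop :=
  Set.BijOn f (unitSpace G) (unitSpace H) ∧ IsEmbedding ((unitSpace G).domRestrict f)

theorem comp_inv_left (a : G) : Comp (inv a) a := by
  simpa [inv_invol] using comp_inv (inv a)

theorem rng_mul_self (a : G) : mul (rng a) a = a := by
  have h := mul_mul_inv (comp_inv a)
  rwa [inv_invol] at h

theorem mul_src_self (a : G) : mul a (src a) = a := by
  have h := inv_mul_mul (comp_inv_left a)
  rwa [inv_invol] at h

theorem comp_rng_self (a : G) : Comp (rng a) a := comp_mul_left (comp_inv a) (comp_inv_left a)

theorem comp_self_src (a : G) : Comp a (src a) := comp_mul_right (comp_inv a) (comp_inv_left a)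

theorem inv_mul_rev {a b : G} (h : Comp a b) : inv (mul a b) = mul (inv b) (inv a) := by
  have h1 : mul (mul a b) (inv b) = a := mul_mul_inv h
  have hc : Comp (mul a b) (inv b) := comp_mul_left h (comp_inv b)
  have h2 : Comp (inv (mul a b)) (mul a b) := comp_inv_left _
  have h3 := inv_mul_mul hc
  rw [h1] at h3
  have h4 : Comp (inv (mul a b)) a := by
    have := comp_mul_right h2 hc
    rwa [h1] at this
  rw [← h3]
  exact (mul_mul_inv h4).symm

theorem rng_mul {a b : G} (h : Comp a b) : rng (mul a b) = rng a := by
  have hc : Comp (mul a b) (inv b) := comp_mul_left h (comp_inv b)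
  have hi : Comp (inv b) (inv a) := by
    have h3 := inv_mul_mul hc
    rw [mul_mul_inv h] at h3
    have h5 : Comp (inv (mul a b)) a := by
      have := comp_mul_right (comp_inv_left (mul a b)) hc
      rwa [mul_mul_inv h] at this
    rw [← h3]
    exact comp_mul_left h5 (comp_inv a)
  unfold rng
  rw [inv_mul_rev h, ← assoc hc hi, mul_mul_inv h]

theorem comp_of_comp_inv_of_eq {a b : G} (h : rng a = rng b) : Comp (inv a) b := by
  have h1 : Comp (inv a) (rng b) := by
    rw [← h]
    exact comp_mul_right (comp_inv_left a) (comp_inv a)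
  have h2 := comp_mul_right h1 (comp_rng_self b)
  rwa [rng_mul_self] at h2

theorem comp_of_src_eq_rng {a b : G} (h : src a = rng b) : Comp a b := by
  have := comp_of_comp_inv_of_eq (a := inv a) (b := b)
    (by rw [← h, rng_eq_src_inv, inv_invol])
  rwa [inv_invol] at this

theorem src_coe_unit (x : unitSpace G) : src (x : G) = x := by
  obtain ⟨_, a, rfl⟩ := x
  have h : rng (src a) = rng (inv a) := rng_mul (comp_inv_left a)
  have h' : inv (src a) = src a := by
    have := inv_mul_rev (comp_inv_left a)
    rwa [inv_invol] at this
  rw [rng_eq_src_inv (inv a), inv_invol, rng, h'] at h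
  change mul (inv (src a)) (src a) = src a
  rw [h', h]

end Groupoids

section Bundle

/-- The product `X × T` with the product topology, where `T` is discrete. -/
@[ext]
structure DiscProd (X T : Type*) where
  fst : X
  snd : T

instance {X T : Type*} [TopologicalSpace X] : TopologicalSpace (DiscProd X T) :=
  TopologicalSpace.induced (fun p => (p.fst, p.snd)) (@instTopologicalSpaceProd X T _ ⊥)

/-- `X × T` as a trivial group bundle over `X` with fibres `T`. -/
instance {X T : Type*} [Group T] : ArrowGroupoid (DiscProd X T) where
  Comp p p' := p.fst = p'.fst
  mul p p' := ⟨p.fst, p.snd * p'.snd⟩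
  inv p := ⟨p.fst, p.snd⁻¹⟩
  inv_invol _ := DiscProd.ext rfl (inv_inv _)
  comp_mul_left h h' := h.trans h'
  comp_mul_right h _ := h
  assoc _ _ := DiscProd.ext rfl (mul_assoc _ _ _)
  comp_inv _ := rfl
  inv_mul_mul h := DiscProd.ext h (inv_mul_cancel_left _ _)
  mul_mul_inv _ := DiscProd.ext rfl (mul_inv_cancel_right _ _)

end Bundle

/-- A discrete `R`-twist `G⁽⁰⁾ × Rˣ → E → G` over `G` (the middle groupoid is called `E`). -/
structure DiscreteTwist (R G E : Type*) [CommRing R]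
    [ArrowGroupoid G] [TopologicalSpace G] [ArrowGroupoid E] [TopologicalSpace E] where
  i : DiscProd (unitSpace G) Rˣ → E
  q : E → G
  continuous_i : Continuous i
  continuous_q : Continuous q
  isHom_i : IsHom i
  isHom_q : IsHom q
  unitHomeo_i : RestrictsToUnitHomeo i
  unitHomeo_q : RestrictsToUnitHomeo q
  /-- Exactness. -/
  image_fibre : ∀ x : unitSpace G, i '' {p | p.fst = x} = q ⁻¹' {(x : G)}
  injective_i : Function.Injective i
  surjective_q : Function.Surjective q
  /-- Local triviality: `(β, t) ↦ i(r(β), t) P(β)` is a homeomorphism of `B × Rˣ` onto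
  `q⁻¹(B)`. -/
  locally_trivial : ∀ a : G, ∃ B : Set G, IsOpenBisection B ∧ a ∈ B ∧
    ∃ P : B → E, Continuous P ∧ (∀ b, q (P b) = b) ∧
      IsEmbedding (fun p : DiscProd B Rˣ => mul (i ⟨rngU (p.fst : G), p.snd⟩) (P p.fst)) ∧
      Set.range (fun p : DiscProd B Rˣ => mul (i ⟨rngU (p.fst : G), p.snd⟩) (P p.fst)) = q ⁻¹' B
  /-- Centrality, where the unit spaces of `E` and `G` are identified through `q`. -/
  central : ∀ (σ : E) (t : Rˣ),
    mul (i ⟨rngU (q σ), t⟩) σ = mul σ (i ⟨srcU (q σ), t⟩)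

/-- A `Γ`-graded discrete `R`-twist. -/
structure GradedDiscreteTwist (R G E Γ : Type*) [CommRing R]
    [ArrowGroupoid G] [TopologicalSpace G] [ArrowGroupoid E] [TopologicalSpace E]
    [Group Γ] [TopologicalSpace Γ] extends DiscreteTwist R G E where
  cE : E → Γ
  cG : G → Γ
  continuous_cE : Continuous cE
  continuous_cG : Continuous cG
  isCocycle_cE : IsCocycle cE
  isCocycle_cG : IsCocycle cG
  comm : cG ∘ q = cE

namespace DiscreteTwist

variable {R G E : Type*} [CommRing R]
    [ArrowGroupoid G] [TopologicalSpace G] [ArrowGroupoid E] [TopologicalSpace E]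
    (W : DiscreteTwist R G E)

/-- The action `t · σ = i(r(σ), t) σ` of `Rˣ` on `E`. -/
def act (t : Rˣ) (σ : E) : E := mul (W.i ⟨rngU (W.q σ), t⟩) σ

/-- `f (t · σ) = t⁻¹ f(σ)`. -/
def IsContravariant (f : E → R) : Prop :=
  ∀ (t : Rˣ) (σ : E), f (W.act t σ) = ((t⁻¹ : Rˣ) : R) * f σ

/-- `q(supp f)`. -/
def suppG (f : E → R) : Set G := W.q '' Function.support f

theorem q_i (x : unitSpace G) (t : Rˣ) : W.q (W.i ⟨x, t⟩) = x := by
  have : W.i ⟨x, t⟩ ∈ W.q ⁻¹' {(x : G)} := by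
    rw [← W.image_fibre]
    exact ⟨⟨x, t⟩, rfl, rfl⟩
  exact this

theorem q_inv (σ : E) : W.q (inv σ) = inv (W.q σ) := by
  -- `q(σ) = q(σ) q(s(σ))` and `q(s(σ)) = q(σ⁻¹) q(σ)`, so `q(σ⁻¹) = q(σ)⁻¹ q(σ) q(σ)⁻¹`
  obtain ⟨hc, h⟩ := W.isHom_q _ _ (comp_inv_left σ)
  have h2 := (W.isHom_q _ _ (comp_self_src σ))
  rw [mul_src_self] at h2
  have h3 : W.q (src σ) = src (W.q σ) := by
    have := inv_mul_mul h2.1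
    rw [← h2.2] at this
    exact this.symm
  have h4 : mul (W.q (inv σ)) (W.q σ) = src (W.q σ) := by rw [← h3, ← h]; rfl
  have h5 := mul_mul_inv hc
  rw [h4] at h5
  have h6 := inv_mul_mul (comp_inv (W.q σ))
  rw [← h5]
  exact (assoc (comp_inv_left _) (comp_inv _)).trans h6

theorem q_rng (σ : E) : W.q (rng σ) = rng (W.q σ) := by
  have := (W.isHom_q _ _ (comp_inv σ)).2
  rw [W.q_inv] at this
  exact this

theorem q_src (σ : E) : W.q (src σ) = src (W.q σ) := by
  have := (W.isHom_q _ _ (comp_inv_left σ)).2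
  rw [W.q_inv] at this
  exact this

/-- Arrows of `E` with composable images in `G` are composable. -/
theorem comp_of_q {σ τ : E} (h : src (W.q σ) = rng (W.q τ)) : Comp σ τ := by
  apply comp_of_src_eq_rng
  apply W.unitHomeo_q.1.injOn (src_mem _) (rng_mem _)
  rw [q_src, q_rng, h]

theorem comp_i (x : unitSpace G) (t : Rˣ) (σ : E) (h : (x : G) = rng (W.q σ)) :
    Comp (W.i ⟨x, t⟩) σ := by
  apply W.comp_of_q
  rw [q_i, src_coe_unit, h]

theorem q_i_mul (x : unitSpace G) (t : Rˣ) (σ : E) (h : (x : G) = rng (W.q σ)) :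
    W.q (mul (W.i ⟨x, t⟩) σ) = W.q σ := by
  rw [(W.isHom_q _ _ (W.comp_i x t σ h)).2, q_i, h, rng_mul_self]

theorem exists_act_of_q_eq {σ τ : E} (h : W.q σ = W.q τ) : ∃ t : Rˣ, τ = W.act t σ := by
  have hc : Comp τ (inv σ) := by
    apply W.comp_of_q
    rw [q_inv, rng_eq_src_inv, inv_invol, h]
  have hq : W.q (mul τ (inv σ)) = rng (W.q σ) := by
    rw [(W.isHom_q _ _ hc).2, q_inv, h]
    rfl
  have hm : mul τ (inv σ) ∈ W.q ⁻¹' {((rngU (W.q σ) : unitSpace G) : G)} := hq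
  rw [← W.image_fibre] at hm
  obtain ⟨⟨x, t⟩, hx, hp⟩ := hm
  refine ⟨t, ?_⟩
  have hx' : x = rngU (W.q σ) := hx
  subst hx'
  have := mul_mul_inv hc
  rw [inv_invol, ← hp] at this
  exact this.symm

theorem isOpenMap_q : IsOpenMap W.q := by
  intro U hU
  rw [isOpen_iff_mem_nhds]
  rintro _ ⟨σ, hσ, rfl⟩
  obtain ⟨B, hB, hmem, P, -, hP, hemb, hran⟩ := W.locally_trivial (W.q σ)
  have : σ ∈ W.q ⁻¹' B := hmem
  rw [← hran] at this
  obtain ⟨⟨b, t⟩, hp⟩ := this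
  let j : B → DiscProd B Rˣ := fun b => ⟨b, t⟩
  have hcont : Continuous j := continuous_induced_rng.2 <|
    @Continuous.prodMk B Rˣ B _ ⊥ _ _ _ continuous_id (@continuous_const B Rˣ _ ⊥ t)
  have hV := hU.preimage (hemb.continuous.comp hcont)
  have hV' := hB.isOpen.isOpenMap_subtype_val _ hV
  have hq : ∀ b : B, W.q (mul (W.i ⟨rngU (b : G), t⟩) (P b)) = b := fun b => by
    rw [W.q_i_mul _ _ _ (by rw [hP]; rfl), hP]
  have hb : W.q σ = b := by rw [← hp]; exact hq b
  refine Filter.mem_of_superset (hV'.mem_nhds (x := W.q σ) ⟨b, ?_, hb.symm⟩) ?_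
  · change mul (W.i ⟨rngU (b : G), t⟩) (P b) ∈ U
    have : mul (W.i ⟨rngU (b : G), t⟩) (P b) = σ := hp
    rwa [this]
  · rintro _ ⟨b', hb', rfl⟩
    exact ⟨_, hb', hq b'⟩

theorem isClosed_suppG {f : E → R} (hf : IsLocallyConstant f) (hc : W.IsContravariant f) :
    IsClosed (W.suppG f) := by
  have : (W.suppG f)ᶜ = W.q '' (f ⁻¹' {0}) := by
    ext a
    constructor
    · intro ha
      obtain ⟨σ, rfl⟩ := W.surjective_q a
      exact ⟨σ, by_contra fun h => ha ⟨σ, h, rfl⟩, rfl⟩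
    · rintro ⟨σ, hσ, rfl⟩ ⟨τ, hτ, h⟩
      obtain ⟨t, rfl⟩ := W.exists_act_of_q_eq h.symm
      apply hτ
      have h0 : f σ = 0 := hσ
      rw [hc, h0, mul_zero]
  rw [← isOpen_compl_iff, this]
  exact W.isOpenMap_q _ (hf _)

/-- The twisted Steinberg algebra `A_R(G; E)`, as an `R`-module with pointwise operations:
locally constant, contravariant functions `f` with `q(supp f)` compact. -/
def steinberg : Submodule R (E → R) where
  carrier := {f | IsLocallyConstant f ∧ W.IsContravariant f ∧ IsCompact (W.suppG f)}
  zero_mem' := by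
    refine ⟨IsLocallyConstant.const 0, fun t σ => by simp, ?_⟩
    simp [suppG]
  add_mem' := by
    rintro f g ⟨hf, hf', hf''⟩ ⟨hg, hg', hg''⟩
    have hc : W.IsContravariant (f + g) := fun t σ => by
      simp only [Pi.add_apply, hf' t σ, hg' t σ, mul_add]
    refine ⟨hf.add hg, hc, (hf''.union hg'').of_isClosed_subset
      (W.isClosed_suppG (hf.add hg) hc) ?_⟩
    rw [suppG, suppG, suppG, ← Set.image_union]
    exact Set.image_mono (Function.support_add f g)
  smul_mem' := by
    rintro c f ⟨hf, hf', hf''⟩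
    have hl : IsLocallyConstant (c • f) := hf.comp (fun x => c • x)
    have hc : W.IsContravariant (c • f) := fun t σ => by
      simp only [Pi.smul_apply, hf' t σ, smul_eq_mul, mul_left_comm]
    refine ⟨hl, hc, hf''.of_isClosed_subset (W.isClosed_suppG hl hc) ?_⟩
    exact Set.image_mono (Function.support_const_smul_subset c f)

/-- The index set `G^{r(σ)} ∩ q(supp f)` of the convolution sum. -/
def convIndex (f : E → R) (σ : E) : Set G := {a | rng a = rng (W.q σ)} ∩ W.suppG f

/-- The convolution product formed with a section `S` (only its values on `q(supp f)` matter):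
`(f * g)(σ) = ∑ f(S(a)) g(S(a)⁻¹ σ)`, the sum over `a ∈ G^{r(σ)} ∩ q(supp f)`. -/
noncomputable def conv (S : G → E) (f g : E → R) (σ : E) : R :=
  ∑ᶠ a ∈ W.convIndex f σ, f (S a) * g (mul (inv (S a)) σ)

end DiscreteTwist

namespace GradedDiscreteTwist

variable {R G E Γ : Type*} [CommRing R]
    [ArrowGroupoid G] [TopologicalSpace G] [ArrowGroupoid E] [TopologicalSpace E]
    [Group Γ] [TopologicalSpace Γ] (W : GradedDiscreteTwist R G E Γ)

/-- The functions `f` in the twisted Steinberg algebra with `q(supp f) ⊆ G_γ = c_G⁻¹(γ)`. -/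
def component (γ : Γ) : Submodule R W.toDiscreteTwist.steinberg where
  carrier := {f | W.toDiscreteTwist.suppG (f : E → R) ⊆ W.cG ⁻¹' {γ}}
  zero_mem' := by simp [DiscreteTwist.suppG]
  add_mem' := by
    rintro f g hf hg _ ⟨σ, hσ, rfl⟩
    rcases Function.support_add (f : E → R) (g : E → R) hσ with h | h
    · exact hf ⟨σ, h, rfl⟩
    · exact hg ⟨σ, h, rfl⟩
  smul_mem' := by
    rintro c f hf _ ⟨σ, hσ, rfl⟩
    exact hf ⟨σ, Function.support_const_smul_subset c (f : E → R) hσ, rfl⟩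

end GradedDiscreteTwist

end TwistedSteinberg

namespace TwistedSteinberg

open ArrowGroupoid Topology Filter

/-! ### Range fibres and products of compact sets in the groupoid -/

section Groupoids

variable {G : Type*} [ArrowGroupoid G]

/-! A compact set in an ample groupoid is covered by finitely many bisections, each meeting a range
fibre at most once, so the convolution sums are finite (`finite_rng_fibre_inter`). Replacing a lift
`τ` by `t · τ` multiplies `f τ` by `t⁻¹` and `g (τ⁻¹ σ)` by `t`, so a summand depends only on the
arrow of `G` below it. Hence any finite family of lifts that covers the index set without repetition
computes the convolution (`sum_eq_conv`); this freedom drives the rest.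

Local constancy follows by moving the finitely many lifts continuously with `σ`: Hausdorffness and
compactness ensure that no index is missed or counted twice nearby. The support of `f * g` lies in
the product of the two supports, which is compact. Associativity is the substitution `c = a⁻¹ b` in
a double sum.

For the grading, each `G_γ` is clopen, so cutting `f` down to degree `γ` stays in the algebra, and a
compact support meets only finitely many degrees. Multiplicativity of `c_G` on the product of
supports gives the degree of a product. -/

theorem src_inv (a : G) : src (inv a) = rng a := (rng_eq_src_inv a).symm

theorem rng_inv (a : G) : rng (inv a) = src a := by rw [rng_eq_src_inv, inv_invol]

theorem src_eq_rng_of_comp {a b : G} (h : Comp a b) : src a = rng b := by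
  have h1 := rng_mul (comp_mul_right (comp_inv_left a) h)
  rw [inv_mul_mul h, rng_inv] at h1
  exact h1.symm

theorem src_mul {a b : G} (h : Comp a b) : src (mul a b) = src b := by
  have hc : Comp (inv b) (inv a) :=
    comp_of_src_eq_rng (by rw [src_inv, rng_inv, src_eq_rng_of_comp h])
  rw [← rng_inv, inv_mul_rev h, rng_mul hc, rng_inv]

theorem mul_inv_mul {a b : G} (h : rng a = rng b) : mul a (mul (inv a) b) = b := by
  have := inv_mul_mul (comp_of_comp_inv_of_eq h)
  rwa [inv_invol] at this

theorem rng_inv_mul {a b : G} (h : rng a = rng b) : rng (mul (inv a) b) = src a := by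
  rw [rng_mul (comp_of_comp_inv_of_eq h), rng_inv]

theorem continuous_rng [TopologicalSpace G] [IsTopGroupoid G] : Continuous (rng : G → G) :=
  (IsTopGroupoid.continuousOn_mul (G := G)).comp_continuous
    (continuous_id.prodMk IsTopGroupoid.continuous_inv) fun a => comp_inv a

theorem continuous_src [TopologicalSpace G] [IsTopGroupoid G] : Continuous (src : G → G) :=
  (IsTopGroupoid.continuousOn_mul (G := G)).comp_continuous
    (IsTopGroupoid.continuous_inv.prodMk continuous_id) fun a => comp_inv_left a

/-- The products `a b` of composable arrows `a ∈ K`, `b ∈ L`. -/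
def mulSet (K L : Set G) : Set G := {c | ∃ a ∈ K, ∃ b ∈ L, Comp a b ∧ mul a b = c}

/-- In a Hausdorff groupoid composability is a closed condition, so the composable pairs in `K × L`
form a compact set, on which multiplication is continuous. -/
theorem isCompact_mulSet [TopologicalSpace G] [T2Space G] [IsTopGroupoid G] {K L : Set G}
    (hK : IsCompact K) (hL : IsCompact L) : IsCompact (mulSet K L) := by
  have hcl : IsClosed {p : G × G | src p.1 = rng p.2} :=
    isClosed_eq (continuous_src.comp continuous_fst) (continuous_rng.comp continuous_snd)
  have hc : IsCompact (K ×ˢ L ∩ {p : G × G | src p.1 = rng p.2}) := (hK.prod hL).inter_right hcl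
  convert hc.image_of_continuousOn ((IsTopGroupoid.continuousOn_mul (G := G)).mono
    fun p hp => comp_of_src_eq_rng hp.2) using 1
  ext c
  constructor
  · rintro ⟨a, ha, b, hb, hab, rfl⟩
    exact ⟨(a, b), ⟨⟨ha, hb⟩, src_eq_rng_of_comp hab⟩, rfl⟩
  · rintro ⟨⟨a, b⟩, ⟨⟨ha, hb⟩, hab⟩, rfl⟩
    exact ⟨a, ha, b, hb, comp_of_src_eq_rng hab, rfl⟩

theorem IsOpenBisection.injOn_rng [TopologicalSpace G] {B : Set G} (hB : IsOpenBisection B) :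
    Set.InjOn rng B := fun a ha b hb h =>
  congrArg Subtype.val (hB.rng_embedding.injective (a₁ := ⟨a, ha⟩) (a₂ := ⟨b, hb⟩) h)

/-- Finitely many open bisections cover `K`, and `r` is injective on each of them. -/
theorem finite_rng_fibre_inter [TopologicalSpace G] [IsAmple G] {K : Set G} (hK : IsCompact K)
    (x : G) : ({a | rng a = x} ∩ K).Finite := by
  obtain ⟨t, ht⟩ := hK.elim_finite_subcover
    (fun B : {B : Set G // IsCompact B ∧ IsOpenBisection B} => B.1) (fun B => B.2.2.isOpen)
    (fun a _ => by
      obtain ⟨B, hB, ha, -⟩ := (IsAmple.isBasis (G := G)).exists_subset_of_mem_open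
        (Set.mem_univ a) isOpen_univ
      exact Set.mem_iUnion.2 ⟨⟨B, hB⟩, ha⟩)
  refine (t.finite_toSet.biUnion (t := fun B => {a | rng a = x} ∩ B.1) fun B _ => ?_).subset ?_
  · exact Set.Subsingleton.finite fun a ha b hb =>
      B.2.2.injOn_rng ha.2 hb.2 (ha.1.trans hb.1.symm)
  · rintro a ⟨ha, haK⟩
    obtain ⟨B, hB, haB⟩ := Set.mem_iUnion₂.1 (ht haK)
    exact Set.mem_iUnion₂.2 ⟨B, hB, ha, haB⟩

end Groupoids

/-! ### Independence of the choice of lifts -/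

namespace DiscreteTwist

variable {R G E : Type*} [CommRing R]
    [ArrowGroupoid G] [TopologicalSpace G] [ArrowGroupoid E] [TopologicalSpace E]
    (W : DiscreteTwist R G E)

theorem rng_eq_of_q {σ τ : E} (h : rng (W.q σ) = rng (W.q τ)) : rng σ = rng τ := by
  apply W.unitHomeo_q.1.injOn (rng_mem _) (rng_mem _)
  rw [q_rng, q_rng, h]

theorem q_inv_mul {σ τ : E} (h : rng (W.q τ) = rng (W.q σ)) :
    W.q (mul (inv τ) σ) = mul (inv (W.q τ)) (W.q σ) := by
  rw [(W.isHom_q _ _ (comp_of_comp_inv_of_eq (W.rng_eq_of_q h))).2, q_inv]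

theorem q_act (t : Rˣ) (σ : E) : W.q (W.act t σ) = W.q σ := W.q_i_mul _ _ _ rfl

/-- Centrality moves the scalar to the right of `σ`, out of reach of left multiplication by `τ⁻¹`,
and then back to the left of the product. -/
theorem inv_mul_act {σ τ : E} (h : rng (W.q τ) = rng (W.q σ)) (t : Rˣ) :
    mul (inv τ) (W.act t σ) = W.act t (mul (inv τ) σ) := by
  have hc : Comp (inv τ) σ := comp_of_comp_inv_of_eq (W.rng_eq_of_q h)
  have hs : srcU (W.q (mul (inv τ) σ)) = srcU (W.q σ) := by
    apply Subtype.ext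
    change src _ = src _
    rw [W.q_inv_mul h, src_mul (comp_of_comp_inv_of_eq h)]
  have hi : Comp σ (W.i ⟨srcU (W.q σ), t⟩) := by
    apply W.comp_of_q
    rw [q_i, ← src_coe_unit (srcU (W.q σ)), rng_eq_src_inv]
    change src (W.q σ) = src (inv (src (src (W.q σ))))
    rw [← rng_eq_src_inv, ← src_eq_rng_of_comp (comp_self_src (src (W.q σ)))]
    exact (src_coe_unit (srcU (W.q σ))).symm
  rw [act, W.central, act, W.central, hs, assoc hc hi]

/-- The summands of the convolution depend only on the image in `G` of the chosen lift. -/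
theorem term_eq_of_q_eq {f g : E → R} (hf : W.IsContravariant f) (hg : W.IsContravariant g)
    {σ τ τ' : E} (hτ : W.q τ = W.q τ') (h : rng (W.q τ) = rng (W.q σ)) :
    f τ' * g (mul (inv τ') σ) = f τ * g (mul (inv τ) σ) := by
  obtain ⟨t, rfl⟩ := W.exists_act_of_q_eq hτ
  have h' : rng (W.q (W.act t τ)) = rng (W.q σ) := hτ ▸ h
  have hr := W.rng_eq_of_q h'
  -- With `τ' = t · τ` this puts a factor `t⁻¹` on `g (τ⁻¹ σ)`, matching the one that `f τ'` carries
  -- on the other side.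
  have h2 : mul (inv τ) σ = W.act t (mul (inv (W.act t τ)) σ) := by
    have hu : rngU (W.q σ) = rngU (W.q τ) := Subtype.ext h.symm
    have c1 : Comp (W.i ⟨rngU (W.q τ), t⟩) τ := W.comp_i _ _ _ rfl
    have c2 : Comp (W.i ⟨rngU (W.q τ), t⟩) σ := W.comp_i _ _ _ h
    have c3 : Comp (inv τ) (inv (W.i ⟨rngU (W.q τ), t⟩)) :=
      comp_of_src_eq_rng (by rw [src_inv, rng_inv, src_eq_rng_of_comp c1])
    rw [← W.inv_mul_act h', act, act, hu, inv_mul_rev c1,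
      assoc c3 (comp_mul_right (comp_inv_left _) c2), inv_mul_mul c2]
  rw [h2, hg, hf]
  ring

/-- Extra members of the family contribute zero, since `f` vanishes on every lift of an arrow
outside `suppG f`. This allows common index sets for different functions, and lifts that vary with
`σ`. -/
theorem sum_eq_conv {ι : Type*} {f g : E → R} (hf : W.IsContravariant f)
    (hg : W.IsContravariant g) {S : G → E} (hS : ∀ a ∈ W.suppG f, W.q (S a) = a) {σ : E}
    (s : Finset ι) (τ : ι → E) (hr : ∀ j ∈ s, rng (W.q (τ j)) = rng (W.q σ))
    (hinj : Set.InjOn (fun j => W.q (τ j)) s)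
    (hsub : ∀ a ∈ W.convIndex f σ, ∃ j ∈ s, W.q (τ j) = a) :
    W.conv S f g σ = ∑ j ∈ s, f (τ j) * g (mul (inv (τ j)) σ) := by
  classical
  have hidx : W.convIndex f σ =
      ((s.filter fun j => W.q (τ j) ∈ W.suppG f).image fun j => W.q (τ j) : Finset G) := by
    ext a
    simp only [Finset.coe_image, Finset.coe_filter, Set.mem_image, Set.mem_ofPred_eq]
    constructor
    · intro ha
      obtain ⟨j, hj, rfl⟩ := hsub a ha
      exact ⟨j, ⟨hj, ha.2⟩, rfl⟩
    · rintro ⟨j, ⟨hj, hj'⟩, rfl⟩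
      exact ⟨hr j hj, hj'⟩
  rw [conv, hidx, finsum_mem_coe_finset, Finset.sum_image, Finset.sum_filter]
  · refine Finset.sum_congr rfl fun j hj => ?_
    split_ifs with h
    · exact W.term_eq_of_q_eq hf hg (hS _ h).symm (hr j hj)
    · rw [show f (τ j) = 0 from by_contra fun h0 => h ⟨_, h0, rfl⟩, zero_mul]
  · exact hinj.mono fun j hj => (Finset.mem_filter.1 hj).1

/-! ### The convolution stays in the algebra -/

theorem isContravariant_conv (S : G → E) {f g : E → R}
    (hS : ∀ a ∈ W.suppG f, W.q (S a) = a) (hfin : ∀ σ, (W.convIndex f σ).Finite)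
    (hg : W.IsContravariant g) : W.IsContravariant (W.conv S f g) := by
  intro t σ
  have hidx : W.convIndex f (W.act t σ) = W.convIndex f σ := by rw [convIndex, convIndex, q_act]
  rw [conv, conv, hidx, mul_finsum_mem' _ _ (hfin σ)]
  refine finsum_mem_congr rfl fun a ha => ?_
  have hr : rng (W.q (S a)) = rng (W.q σ) := by rw [hS a ha.2]; exact ha.1
  rw [W.inv_mul_act hr, hg, mul_left_comm]

/-- A nonzero value at `σ` forces a nonzero summand, whose index `a` splits `q σ` as `a (a⁻¹ q σ)`.
-/
theorem suppG_conv_subset (S : G → E) {f g : E → R} (hS : ∀ a ∈ W.suppG f, W.q (S a) = a) :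
    W.suppG (W.conv S f g) ⊆ mulSet (W.suppG f) (W.suppG g) := by
  rintro _ ⟨σ, hσ, rfl⟩
  obtain ⟨a, ha, h0⟩ := exists_ne_zero_of_finsum_mem_ne_zero hσ
  have hr : rng (W.q (S a)) = rng (W.q σ) := by rw [hS a ha.2]; exact ha.1
  refine ⟨a, ha.2, mul (inv a) (W.q σ),
    ⟨mul (inv (S a)) σ, right_ne_zero_of_mul h0, ?_⟩, ?_, mul_inv_mul ha.1⟩
  · rw [W.q_inv_mul hr, hS a ha.2]
  · exact comp_of_src_eq_rng (rng_inv_mul ha.1).symm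

/-- Arrows of `G` with the range of `σ₀` lift to `E` continuously near `σ₀`. -/
theorem exists_local_lift [IsTopGroupoid G] {σ₀ : E} {a : G} (h : rng a = rng (W.q σ₀)) :
    ∃ B : Set G, IsOpenBisection B ∧ a ∈ B ∧ ∃ τ : E → E, ContinuousAt τ σ₀ ∧ W.q (τ σ₀) = a ∧
      ∀ᶠ σ in 𝓝 σ₀, W.q (τ σ) ∈ B ∧ rng (W.q (τ σ)) = rng (W.q σ) := by
  obtain ⟨B, hB, ha, P, hP, hqP, -⟩ := W.locally_trivial a
  have hran : Set.range (B.domRestrict rng) = rng '' B := Set.range_domRestrict _ _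
  have ho : IsOpenEmbedding (B.domRestrict rng) := ⟨hB.rng_embedding, hran ▸ hB.isOpen_rng⟩
  have : Nonempty B := ⟨⟨a, ha⟩⟩
  -- The inverse of `r` on `B` turns `r (q σ)` into an arrow of `B` with that range, which `P` then
  -- lifts to `E`.
  let e := ho.toOpenPartialHomeomorph
  have hcont : Continuous fun σ => rng (W.q σ) := continuous_rng.comp W.continuous_q
  have hmem : rng (W.q σ₀) ∈ e.target := by
    rw [← h]; simpa [e, hran] using ⟨a, ha, rfl⟩
  have hea : e.symm (rng (W.q σ₀)) = ⟨a, ha⟩ := by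
    rw [← h]
    exact e.left_inv (x := ⟨a, ha⟩) (by simp [e])
  refine ⟨B, hB, ha, fun σ => P (e.symm (rng (W.q σ))), ?_, ?_, ?_⟩
  · exact hP.continuousAt.comp ((e.continuousAt_symm hmem).comp_of_eq hcont.continuousAt rfl)
  · rw [hqP, hea]
  · filter_upwards [hcont.continuousAt.preimage_mem_nhds (e.open_target.mem_nhds hmem)] with σ hσ
    rw [hqP]
    exact ⟨Subtype.coe_prop _, e.right_inv hσ⟩

/-- The finitely many indices at `σ₀` have lifts `τ a` varying continuously with `σ`. Near `σ₀`
these still compute the convolution, and each summand is locally constant because `f` and `g` are.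
-/
theorem isLocallyConstant_conv [T2Space G] [IsAmple G] [IsTopGroupoid E] (S : G → E) {f g : E → R}
    (hS : ∀ a ∈ W.suppG f, W.q (S a) = a)
    (hf : f ∈ W.steinberg) (hg : g ∈ W.steinberg) : IsLocallyConstant (W.conv S f g) := by
  rw [IsLocallyConstant.iff_eventually_eq]
  intro σ₀
  have hfin : (W.convIndex f σ₀).Finite := finite_rng_fibre_inter hf.2.2 _
  choose B hB haB τ hτ hqτ hev using
    fun a : W.convIndex f σ₀ => W.exists_local_lift (σ₀ := σ₀) a.2.1
  have : Fintype (W.convIndex f σ₀) := hfin.fintype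
  have hcr : Continuous fun σ => rng (W.q σ) := continuous_rng.comp W.continuous_q
  -- The part of the support missed by the bisections `B a` has compact, hence closed, range image.
  -- It avoids `r (q σ₀)`, so near `σ₀` every index lies in some `B a`, where injectivity of `r`
  -- identifies it with `q (τ a σ)`.
  have hK : IsCompact (rng '' (W.suppG f \ ⋃ a, B a)) :=
    (hf.2.2.diff (isOpen_iUnion fun a => (hB a).isOpen)).image continuous_rng
  have hnear : ∀ᶠ σ in 𝓝 σ₀, rng (W.q σ) ∉ rng '' (W.suppG f \ ⋃ a, B a) := by
    refine hcr.continuousAt.eventually (hK.isClosed.isOpen_compl.mem_nhds ?_)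
    rintro ⟨a, ⟨ha, hn⟩, har⟩
    exact hn (Set.mem_iUnion.2 ⟨⟨a, har, ha⟩, haB _⟩)
  have hq : ∀ a, Tendsto (fun σ => W.q (τ a σ)) (𝓝 σ₀) (𝓝 (a : G)) := fun a => by
    have := W.continuous_q.continuousAt.comp (hτ a)
    simpa only [ContinuousAt, Function.comp_def, hqτ] using this
  -- Distinct indices stay distinct near `σ₀`, so none is counted twice.
  have hne : ∀ᶠ σ in 𝓝 σ₀, ∀ a b, a ≠ b → W.q (τ a σ) ≠ W.q (τ b σ) := by
    simp only [eventually_all]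
    intro a b hab
    have hab' : ((a : G), (b : G)) ∈ (Set.diagonal G)ᶜ := fun h => hab (Subtype.ext h)
    exact ((hq a).prodMk_nhds (hq b)).eventually (isClosed_diagonal.isOpen_compl.mem_nhds hab')
  have hterm : ∀ᶠ σ in 𝓝 σ₀, ∀ a, f (τ a σ) * g (mul (inv (τ a σ)) σ) =
      f (τ a σ₀) * g (mul (inv (τ a σ₀)) σ₀) := by
    rw [eventually_all]
    intro a
    have h1 : ∀ᶠ σ in 𝓝 σ₀, f (τ a σ) = f (τ a σ₀) :=
      (hτ a).eventually ((IsLocallyConstant.iff_eventually_eq _).1 hf.1 _)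
    have hcomp : ∀ σ, rng (W.q (τ a σ)) = rng (W.q σ) → Comp (inv (τ a σ)) σ := fun σ h =>
      comp_of_comp_inv_of_eq (W.rng_eq_of_q h)
    have hmul : Tendsto (fun σ => mul (inv (τ a σ)) σ) (𝓝 σ₀) (𝓝 (mul (inv (τ a σ₀)) σ₀)) := by
      have hw := IsTopGroupoid.continuousOn_mul (G := E) (inv (τ a σ₀), σ₀)
        (hcomp σ₀ (hev a).self_of_nhds.2)
      refine Tendsto.comp (g := fun p : E × E => mul p.1 p.2) (f := fun σ => (inv (τ a σ), σ))
        hw.tendsto (tendsto_nhdsWithin_iff.2 ⟨?_, ?_⟩)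
      · exact (IsTopGroupoid.continuous_inv.continuousAt.comp (hτ a)).prodMk_nhds tendsto_id
      · filter_upwards [hev a] with σ hσ using hcomp σ hσ.2
    have h2 := hmul.eventually ((IsLocallyConstant.iff_eventually_eq _).1 hg.1 _)
    filter_upwards [h1, h2] with σ h1 h2
    rw [h1, h2]
  have hconv : ∀ᶠ σ in 𝓝 σ₀, W.conv S f g σ = ∑ a, f (τ a σ) * g (mul (inv (τ a σ)) σ) := by
    filter_upwards [hnear, hne, eventually_all.2 hev] with σ hσ hne hev
    refine W.sum_eq_conv hf.2.1 hg.2.1 hS _ (fun a => τ a σ) (fun a _ => (hev a).2) ?_ ?_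
    · intro a _ b _ hab
      by_contra h
      exact hne a b h hab
    · rintro c ⟨hcr, hc⟩
      by_contra! hcon
      refine hσ ⟨c, ⟨hc, fun hcB => ?_⟩, hcr⟩
      obtain ⟨a, ha⟩ := Set.mem_iUnion.1 hcB
      exact hcon a (Finset.mem_univ _)
        ((hB a).injOn_rng (hev a).1 ha ((hev a).2.trans hcr.symm))
  filter_upwards [hconv, hterm] with σ h1 h2
  rw [h1, hconv.self_of_nhds]
  exact Finset.sum_congr rfl fun a _ => h2 a

theorem finite_convIndex [IsAmple G] {f : E → R} (hf : f ∈ W.steinberg) (σ : E) :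
    (W.convIndex f σ).Finite := finite_rng_fibre_inter hf.2.2 _

theorem conv_mem_steinberg [T2Space G] [IsAmple G] [IsTopGroupoid E] (S : G → E) {f g : E → R}
    (hS : ∀ a ∈ W.suppG f, W.q (S a) = a)
    (hf : f ∈ W.steinberg) (hg : g ∈ W.steinberg) : W.conv S f g ∈ W.steinberg := by
  have hl := W.isLocallyConstant_conv S hS hf hg
  have hc := W.isContravariant_conv S hS (W.finite_convIndex hf) hg.2.1
  exact ⟨hl, hc, (isCompact_mulSet hf.2.2 hg.2.2).of_isClosed_subset
    (W.isClosed_suppG hl hc) (W.suppG_conv_subset S hS)⟩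

/-- A section of `q`. -/
noncomputable def sec : G → E := Function.surjInv W.surjective_q

theorem q_sec (a : G) : W.q (W.sec a) = a := Function.surjInv_eq _ a

/-! ### Bilinearity and associativity -/

theorem conv_eq_sum_sec {f g : E → R} (hf : W.IsContravariant f)
    (hg : W.IsContravariant g) {S : G → E} (hS : ∀ a ∈ W.suppG f, W.q (S a) = a) {σ : E}
    (s : Finset G) (hr : ∀ a ∈ s, rng a = rng (W.q σ)) (hsub : W.convIndex f σ ⊆ s) :
    W.conv S f g σ = ∑ a ∈ s, f (W.sec a) * g (mul (inv (W.sec a)) σ) := by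
  refine W.sum_eq_conv hf hg hS s W.sec (fun a ha => ?_) (fun a _ b _ h => ?_) fun a ha => ?_
  · rw [q_sec, hr a ha]
  · simpa only [q_sec] using h
  · exact ⟨a, hsub ha, W.q_sec a⟩

/-- The convolution product on the twisted Steinberg algebra. -/
noncomputable def convMap [T2Space G] [IsAmple G] [IsTopGroupoid E] :
    W.steinberg →ₗ[R] W.steinberg →ₗ[R] W.steinberg :=
  LinearMap.mk₂ R
    (fun f g => ⟨W.conv W.sec f g,
      W.conv_mem_steinberg W.sec (fun a _ => W.q_sec a) f.2 g.2⟩)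
    (fun f f' g => by
      classical
      ext σ
      have h1 := W.finite_convIndex f.2 σ
      have h2 := W.finite_convIndex f'.2 σ
      have h3 := W.finite_convIndex (f + f').2 σ
      -- The supports of `f`, `f'` and `f + f'` may differ, by cancellation for instance, so all
      -- three sums are extended to one index set.
      set s := h1.toFinset ∪ h2.toFinset ∪ h3.toFinset with hs
      have hr : ∀ a ∈ s, rng a = rng (W.q σ) := by
        intro a ha
        simp only [hs, Finset.mem_union, Set.Finite.mem_toFinset] at ha
        rcases ha with (h | h) | h <;> exact h.1
      change W.conv W.sec _ _ σ = W.conv W.sec _ _ σ + W.conv W.sec _ _ σ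
      rw [W.conv_eq_sum_sec (f + f').2.2.1 g.2.2.1 (fun a _ => W.q_sec a) s hr
          (fun a ha => Finset.mem_union_right _ (h3.mem_toFinset.2 ha)),
        W.conv_eq_sum_sec f.2.2.1 g.2.2.1 (fun a _ => W.q_sec a) s hr
          (by intro a ha; simp [hs, ha]),
        W.conv_eq_sum_sec f'.2.2.1 g.2.2.1 (fun a _ => W.q_sec a) s hr
          (by intro a ha; simp [hs, ha]), ← Finset.sum_add_distrib]
      exact Finset.sum_congr rfl fun a _ => add_mul _ _ _)
    (fun c f g => by
      classical
      ext σ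
      have h1 := W.finite_convIndex f.2 σ
      have h3 := W.finite_convIndex (c • f).2 σ
      set s := h1.toFinset ∪ h3.toFinset with hs
      have hr : ∀ a ∈ s, rng a = rng (W.q σ) := by
        intro a ha
        simp only [hs, Finset.mem_union, Set.Finite.mem_toFinset] at ha
        rcases ha with h | h <;> exact h.1
      change W.conv W.sec _ _ σ = c * W.conv W.sec _ _ σ
      rw [W.conv_eq_sum_sec (c • f).2.2.1 g.2.2.1 (fun a _ => W.q_sec a) s hr
          (fun a ha => Finset.mem_union_right _ (h3.mem_toFinset.2 ha)),
        W.conv_eq_sum_sec f.2.2.1 g.2.2.1 (fun a _ => W.q_sec a) s hr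
          (by intro a ha; simp [hs, ha]), Finset.mul_sum]
      exact Finset.sum_congr rfl fun a _ => mul_assoc _ _ _)
    (fun f g g' => by
      ext σ
      change W.conv W.sec _ _ σ = W.conv W.sec _ _ σ + W.conv W.sec _ _ σ
      rw [conv, conv, conv, ← finsum_mem_add_distrib (W.finite_convIndex f.2 σ)]
      exact finsum_mem_congr rfl fun a _ => mul_add _ _ _)
    (fun c f g => by
      ext σ
      change W.conv W.sec _ _ σ = c * W.conv W.sec _ _ σ
      rw [conv, conv, mul_finsum_mem' _ _ (W.finite_convIndex f.2 σ)]
      exact finsum_mem_congr rfl fun a _ => mul_left_comm _ _ _)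

theorem convMap_apply [T2Space G] [IsAmple G] [IsTopGroupoid E] (f g : W.steinberg) {S : G → E}
    (hS : ∀ a ∈ W.suppG (f : E → R), W.q (S a) = a) (σ : E) :
    (W.convMap f g : E → R) σ = W.conv S f g σ := by
  have h1 := W.finite_convIndex f.2 σ
  have hr : ∀ a ∈ h1.toFinset, rng a = rng (W.q σ) := fun a ha => (h1.mem_toFinset.1 ha).1
  rw [W.conv_eq_sum_sec f.2.2.1 g.2.2.1 hS h1.toFinset hr (by simp)]
  exact W.conv_eq_sum_sec f.2.2.1 g.2.2.1 (fun a _ => W.q_sec a) h1.toFinset hr (by simp)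

theorem convMap_eq_sum [T2Space G] [IsAmple G] [IsTopGroupoid E] (f g : W.steinberg) {σ : E}
    {ι : Type*} (s : Finset ι) (τ : ι → E) (hr : ∀ j ∈ s, rng (W.q (τ j)) = rng (W.q σ))
    (hinj : Set.InjOn (fun j => W.q (τ j)) s)
    (hsub : ∀ a ∈ W.convIndex (f : E → R) σ, ∃ j ∈ s, W.q (τ j) = a) :
    (W.convMap f g : E → R) σ =
      ∑ j ∈ s, (f : E → R) (τ j) * (g : E → R) (mul (inv (τ j)) σ) :=
  W.sum_eq_conv f.2.2.1 g.2.2.1 (fun a _ => W.q_sec a) s τ hr hinj hsub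

/-- Writing `a`, `b` also for their chosen lifts, both sides equal the double sum of `f(a) g(a⁻¹ b)
h(b⁻¹ σ)` over `a ∈ s`, `b ∈ u`; only the order of summation differs. -/
theorem convMap_assoc [T2Space G] [IsAmple G] [IsTopGroupoid E] (f g h : W.steinberg) :
    W.convMap (W.convMap f g) h = W.convMap f (W.convMap g h) := by
  classical
  ext σ
  -- `s` indexes the left factors, `u` contains all products of the first two factors
  have hs := W.finite_convIndex f.2 σ
  set s : Finset G := hs.toFinset
  have hu : ({a | rng a = rng (W.q σ)} ∩
      mulSet (W.suppG (f : E → R)) (W.suppG (g : E → R))).Finite :=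
    finite_rng_fibre_inter (isCompact_mulSet f.2.2.2 g.2.2.2) _
  set u : Finset G := hu.toFinset
  have hsr : ∀ a ∈ s, rng a = rng (W.q σ) := fun a ha => (hs.mem_toFinset.1 ha).1
  have hur : ∀ b ∈ u, rng b = rng (W.q σ) := fun b hb => (hu.mem_toFinset.1 hb).1
  have hinj : ∀ v : Set G, Set.InjOn (fun a => W.q (W.sec a)) v := fun v a _ b _ hab => by
    simpa only [q_sec] using hab
  have hL : (W.convMap (W.convMap f g) h : E → R) σ = ∑ b ∈ u, ∑ a ∈ s,
      (f : E → R) (W.sec a) * (g : E → R) (mul (inv (W.sec a)) (W.sec b)) *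
        (h : E → R) (mul (inv (W.sec b)) σ) := by
    rw [W.convMap_eq_sum _ _ u W.sec (fun b hb => by rw [q_sec, hur b hb]) (hinj _)]
    · refine Finset.sum_congr rfl fun b hb => ?_
      rw [← Finset.sum_mul, W.convMap_eq_sum _ _ s W.sec _ (hinj _)]
      · rintro a ⟨ha, ha'⟩
        refine ⟨a, hs.mem_toFinset.2 ⟨?_, ha'⟩, W.q_sec a⟩
        have ha : rng a = rng (W.q (W.sec b)) := ha
        rw [q_sec, hur b hb] at ha
        exact ha
      · intro a ha
        rw [q_sec, q_sec, hsr a ha, hur b hb]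
    · rintro b ⟨hb, hb'⟩
      exact ⟨b, hu.mem_toFinset.2 ⟨hb, W.suppG_conv_subset W.sec (fun a _ => W.q_sec a) hb'⟩,
        W.q_sec b⟩
  have hR : (W.convMap f (W.convMap g h) : E → R) σ = ∑ a ∈ s, ∑ b ∈ u,
      (f : E → R) (W.sec a) * (g : E → R) (mul (inv (W.sec a)) (W.sec b)) *
        (h : E → R) (mul (inv (W.sec b)) σ) := by
    rw [W.convMap_eq_sum _ _ s W.sec (fun b hb => by rw [q_sec, hsr b hb]) (hinj _)]
    · refine Finset.sum_congr rfl fun a ha => ?_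
      have hab : ∀ b ∈ u, rng (W.q (W.sec a)) = rng (W.q (W.sec b)) := fun b hb => by
        rw [q_sec, q_sec, hsr a ha, hur b hb]
      have haσ : rng (W.q (W.sec a)) = rng (W.q σ) := by rw [q_sec, hsr a ha]
      have hqa : ∀ b ∈ u, W.q (mul (inv (W.sec a)) (W.sec b)) = mul (inv a) b := fun b hb => by
        rw [W.q_inv_mul (hab b hb), q_sec, q_sec]
      have hru : ∀ b ∈ u, rng a = rng b := fun b hb => (hsr a ha).trans (hur b hb).symm
      -- The inner product `g * h` is computed with the lifts `sec(a)⁻¹ sec(b)`, so that `sec(a)`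
      -- cancels exactly, without scalar corrections.
      rw [W.convMap_eq_sum _ _ u (fun b => mul (inv (W.sec a)) (W.sec b)), Finset.mul_sum]
      · refine Finset.sum_congr rfl fun b hb => ?_
        have e : mul (inv (mul (inv (W.sec a)) (W.sec b))) (mul (inv (W.sec a)) σ) =
            mul (inv (W.sec b)) σ := by
          have h1 := W.rng_eq_of_q (hab b hb)
          have h2 := W.rng_eq_of_q haσ
          have c1 : Comp (inv (W.sec a)) (W.sec b) := comp_of_comp_inv_of_eq h1
          rw [inv_mul_rev c1, inv_invol,
            assoc (comp_of_comp_inv_of_eq h1.symm), mul_inv_mul h2]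
          exact comp_of_src_eq_rng (rng_inv_mul h2).symm
        rw [e, mul_assoc]
      · intro b hb
        rw [hqa b hb, W.q_inv_mul haσ, q_sec, rng_inv_mul (hru b hb), rng_inv_mul (hsr a ha)]
      · intro b hb b' hb' e
        have e : W.q (mul (inv (W.sec a)) (W.sec b)) = W.q (mul (inv (W.sec a)) (W.sec b')) := e
        rw [hqa b hb, hqa b' hb'] at e
        rw [← mul_inv_mul (hru b hb), e, mul_inv_mul (hru b' hb')]
      -- An index `c` of the inner sum comes from `b = a c`, which lies in `u`.
      · rintro c ⟨hc, hc'⟩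
        have hc : rng c = rng (W.q (mul (inv (W.sec a)) σ)) := hc
        rw [W.q_inv_mul haσ, q_sec, rng_inv_mul (hsr a ha)] at hc
        have hcomp : Comp a c := comp_of_src_eq_rng hc.symm
        have hmem : mul a c ∈ u := hu.mem_toFinset.2
          ⟨(rng_mul hcomp).trans (hsr a ha), a, (hs.mem_toFinset.1 ha).2, c, hc', hcomp, rfl⟩
        exact ⟨_, hmem, by rw [hqa _ hmem, inv_mul_mul hcomp]⟩
    · intro a ha
      exact ⟨a, hs.mem_toFinset.2 ha, W.q_sec a⟩
  rw [hL, hR, Finset.sum_comm]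

end DiscreteTwist

/-! ### The grading -/

namespace GradedDiscreteTwist

variable {R G E Γ : Type*} [CommRing R]
    [ArrowGroupoid G] [TopologicalSpace G] [ArrowGroupoid E] [TopologicalSpace E]
    [Group Γ] [TopologicalSpace Γ] (W : GradedDiscreteTwist R G E Γ)

theorem convMap_mem_component [T2Space G] [IsAmple G] [IsTopGroupoid E] {γ δ : Γ}
    {f g : W.toDiscreteTwist.steinberg} (hf : f ∈ W.component γ) (hg : g ∈ W.component δ) :
    W.toDiscreteTwist.convMap f g ∈ W.component (γ * δ) := by
  intro c hc
  obtain ⟨a, ha, b, hb, hab, rfl⟩ := W.toDiscreteTwist.suppG_conv_subset _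
    (fun a _ => W.toDiscreteTwist.q_sec a) hc
  have h1 : W.cG a = γ := hf ha
  have h2 : W.cG b = δ := hg hb
  change W.cG (mul a b) = γ * δ
  rw [W.isCocycle_cG a b hab, h1, h2]

/-- The homogeneous part of degree `γ` of a function on `E`. -/
noncomputable def homogeneousPart (γ : Γ) (f : E → R) : E → R :=
  (W.q ⁻¹' (W.cG ⁻¹' {γ})).indicator f

theorem homogeneousPart_apply_self (f : E → R) (σ : E) :
    W.homogeneousPart (W.cG (W.q σ)) f σ = f σ :=
  Set.indicator_of_mem (s := W.q ⁻¹' (W.cG ⁻¹' {W.cG (W.q σ)})) rfl f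

theorem homogeneousPart_apply_of_ne (f : E → R) {γ : Γ} {σ : E} (h : W.cG (W.q σ) ≠ γ) :
    W.homogeneousPart γ f σ = 0 :=
  Set.indicator_of_notMem (s := W.q ⁻¹' (W.cG ⁻¹' {γ})) h f

theorem suppG_homogeneousPart_subset (γ : Γ) (f : E → R) :
    W.toDiscreteTwist.suppG (W.homogeneousPart γ f) ⊆ W.cG ⁻¹' {γ} := by
  rintro _ ⟨σ, hσ, rfl⟩
  exact (Set.mem_of_indicator_ne_zero hσ : σ ∈ W.q ⁻¹' (W.cG ⁻¹' {γ}))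

/-- Since `Γ` is discrete, the degree-`γ` part of `E` is clopen, and the action of `Rˣ` preserves
degrees. -/
theorem homogeneousPart_mem_steinberg [DiscreteTopology Γ] (γ : Γ) {f : E → R}
    (hf : f ∈ W.toDiscreteTwist.steinberg) :
    W.homogeneousPart γ f ∈ W.toDiscreteTwist.steinberg := by
  have hl : IsLocallyConstant (W.homogeneousPart γ f) :=
    (LocallyConstant.indicator ⟨f, hf.1⟩
      (((isClopen_discrete {γ}).preimage W.continuous_cG).preimage W.continuous_q)).isLocallyConstant
  have hc : W.toDiscreteTwist.IsContravariant (W.homogeneousPart γ f) := by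
    intro t σ
    have hq := W.toDiscreteTwist.q_act t σ
    by_cases h : W.cG (W.q σ) = γ
    · subst h
      rw [homogeneousPart_apply_self, ← hq, homogeneousPart_apply_self, hf.2.1]
    · rw [W.homogeneousPart_apply_of_ne f h, W.homogeneousPart_apply_of_ne f (hq ▸ h), mul_zero]
  refine ⟨hl, hc, hf.2.2.of_isClosed_subset (W.toDiscreteTwist.isClosed_suppG hl hc) ?_⟩
  exact Set.image_mono fun σ hσ => fun h0 => hσ (by simp [homogeneousPart, Set.indicator, h0])

theorem iSup_component [DiscreteTopology Γ] : ⨆ γ, W.component γ = ⊤ := by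
  classical
  rw [eq_top_iff]
  intro f _
  -- A compact subset of a discrete space is finite, so `f` has finitely many nonzero homogeneous
  -- parts.
  have hfin : (W.cG '' W.toDiscreteTwist.suppG (f : E → R)).Finite :=
    (f.2.2.2.image W.continuous_cG).finite_of_discrete
  have hsum : f = ∑ γ ∈ hfin.toFinset,
      (⟨W.homogeneousPart γ f, W.homogeneousPart_mem_steinberg γ f.2⟩ :
        W.toDiscreteTwist.steinberg) := by
    ext σ
    rw [Submodule.coe_sum, Finset.sum_apply, Finset.sum_eq_single (W.cG (W.q σ))]
    · exact (W.homogeneousPart_apply_self f σ).symm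
    · intro γ _ hγ
      exact W.homogeneousPart_apply_of_ne f hγ.symm
    · intro hn
      by_contra h0
      refine hn (hfin.mem_toFinset.2 ⟨_, ⟨σ, fun h => h0 ?_, rfl⟩, rfl⟩)
      exact (W.homogeneousPart_apply_self f σ).trans h
  rw [hsum]
  exact Submodule.sum_mem _ fun γ _ =>
    Submodule.mem_iSup_of_mem γ (W.suppG_homogeneousPart_subset γ f)

/-- The functions in the twisted Steinberg algebra that vanish in degree `γ`. -/
def vanishing (γ : Γ) : Submodule R W.toDiscreteTwist.steinberg where
  carrier := {f | ∀ σ, W.cG (W.q σ) = γ → (f : E → R) σ = 0}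
  zero_mem' _ _ := rfl
  add_mem' hf hg σ hσ := by
    change (_ : R) + _ = 0
    rw [hf σ hσ, hg σ hσ, add_zero]
  smul_mem' c f hf σ hσ := by
    change c * (_ : R) = 0
    rw [hf σ hσ, mul_zero]

/-- Elements of the other components vanish in degree `γ`, hence so does everything in their span,
while an element of degree `γ` vanishes outside it. -/
theorem iSupIndep_component : iSupIndep W.component := by
  intro γ
  rw [Submodule.disjoint_def]
  intro f hf hf'
  have hle : ⨆ (δ) (_ : δ ≠ γ), W.component δ ≤ W.vanishing γ := by
    refine iSup₂_le fun δ hδ g hg σ hσ => ?_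
    by_contra h0
    exact hδ ((hg ⟨σ, h0, rfl⟩ : W.cG (W.q σ) = δ).symm.trans hσ)
  ext σ
  by_contra h0
  exact h0 (hle hf' σ (hf ⟨σ, h0, rfl⟩))

end GradedDiscreteTwist

end TwistedSteinberg

theorem mainTheorem7 {R G E Γ : Type*} [CommRing R]
    [TwistedSteinberg.ArrowGroupoid G] [TopologicalSpace G] [T2Space G]
    [TwistedSteinberg.IsAmple G]
    [TwistedSteinberg.ArrowGroupoid E] [TopologicalSpace E] [TwistedSteinberg.IsTopGroupoid E]
    [Group Γ] [DecidableEq Γ] [TopologicalSpace Γ] [DiscreteTopology Γ]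
    (W : TwistedSteinberg.GradedDiscreteTwist R G E Γ) :
    -- the convolution is an associative `R`-bilinear product on `A_R(G; E)`
    ∃ m : W.toDiscreteTwist.steinberg →ₗ[R] W.toDiscreteTwist.steinberg →ₗ[R]
        W.toDiscreteTwist.steinberg,
      (∀ (f g : W.toDiscreteTwist.steinberg) (S : G → E),
        (∀ a ∈ W.toDiscreteTwist.suppG (f : E → R), W.q (S a) = a) →
        ∀ σ : E, (W.toDiscreteTwist.convIndex (f : E → R) σ).Finite ∧
          (m f g : E → R) σ = W.toDiscreteTwist.conv S (f : E → R) (g : E → R) σ) ∧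
      (∀ f g h : W.toDiscreteTwist.steinberg, m (m f g) h = m f (m g h)) ∧
      -- and `A_R(G; E)` is graded by the components
      DirectSum.IsInternal (fun γ : Γ => W.component γ) ∧
      (∀ (γ δ : Γ) (f g : W.toDiscreteTwist.steinberg),
        f ∈ W.component γ → g ∈ W.component δ → m f g ∈ W.component (γ * δ)) := by
  refine ⟨W.toDiscreteTwist.convMap, fun f g S hS σ =>
    ⟨W.toDiscreteTwist.finite_convIndex f.2 σ, W.toDiscreteTwist.convMap_apply f g hS σ⟩,
    W.toDiscreteTwist.convMap_assoc, ?_, fun γ δ f g hf hg => W.convMap_mem_component hf hg⟩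
  exact DirectSum.isInternal_submodule_of_iSupIndep_of_iSup_eq_top W.iSupIndep_component
    W.iSup_component
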